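/- A tract $F=(G,N_G)$ is an abelian group $G$, written multiplicatively, with a subset $N_G\subseteq\mathbb N[G]$ such that $0\in N_G$, $1\notin N_G$, there is a unique $\epsilon\in G$ with $1+\epsilon\in N_G$, and $N_G$ is stable under multiplication by elements of $G$. Put $F=G\cup\{0\}\subset\mathbb N[G]$, $F^\times=G$, and $-x=\epsilon x$ for $x\in F$. Let $x\mapsto\overline x$ be an involution of $F$, i.e. a group homomorphism $G\to G$ (extended to $F$ by $\overline 0=0$) with square the identity whose $\mathbb N$-linear extension to $\mathbb N[G]$ maps $N_G$ into $N_G$. Let $E$ be a finite set. For $X\in F^E$ let $\underline X=\{e\in E: X(e)\neq0\}$ be its support. For $X,Y\in F^E$ write $X\perp Y$ if $\sum_{e\in E}X(e)\overline{Y(e)}\in N_G$, and for $S\subseteq F^E$ let $S^\perp=\{X\in F^E: X\perp Y\text{ for all }Y\in S\}$. A set $\mathcal C\subseteq F^E$ is the set of $F$-circuits of a strong $F$-matroid on $E$ if: (C0) $0\notin\mathcal C$; (C1) if $X\in\mathcal C$ and $\alpha\in F^\times$, then $\alpha X\in\mathcal C$; (C2) if $X,Y\in\mathcal C$ and $\underline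 X\subseteq\underline Y$, then $X=\alpha Y$ for some $\alpha\in F^\times$; (C3) if $X,X_1,\dots,X_k\in\mathcal C$ form a modular family, $\underline X\not\subseteq\bigcup_{i}\underline X_i$, and $e_i\in(\underline X\cap\underline X_i)\setminus\bigcup_{j\ne i}\underline X_j$ satisfies $X(e_i)=-X_i(e_i)$ for $1\le i\le k$, then there is $Z\in\mathcal C$ with $Z(e_i)=0$ for $1\le i\le k$ and $X_1(f)+\cdots+X_k(f)+X(f)-Z(f)\in N_G$ for all $f\in E$. Here $X,X_1,\dots,X_k$ form a modular family if the height of $\underline X\cup\underline X_1\cup\cdots\cup\underline X_k$ in the lattice of all unions (including the empty one) of supports of elements of $\mathcal C$, ordered by inclusion, is $k+1$; the height of an element $U$ is the largest $n$ for which there is a chain $U_0\subsetneq\cdots\subsetneq U_n=U$ in the lattice. The underlying matroid of such a strong $F$-matroid is the matroid on $E$ whose circuits are the supports of its $F$-circuits. Its $F$-cocircuits are the $F$-circuits of its dual, i.e. of the strong $F$-matroid on $E$ whose set of $F$-circuits is the set of elements of $\mathcal C^\perp\setminus\{0\}$ of minimal support. An $F$-signature of a matroid $M$ on $E$ is a set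 $\mathcal C\subseteq F^E$ satisfying (C0) and (C1) such that $X\mapsto\underline X$ induces a bijection from the set of classes of elements of $\mathcal C$ modulo scaling by $F^\times$ to the set of circuits of $M$. **Theorem.** Let $M$ be a matroid on $E$, let $\mathcal C$ be an $F$-signature of $M$, and let $\mathcal D$ be an $F$-signature of the dual matroid $M^*$. Then $\mathcal C$ and $\mathcal D$ are the set of $F$-circuits and the set of $F$-cocircuits, respectively, of a strong $F$-matroid with underlying matroid $M$ if and only if $X\perp Y$ for all $X\in\mathcal C$ and $Y\in\mathcal D$. -/

import Mathlib

universe u v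

/-- A tract: an abelian group `G` (written multiplicatively) together with a subset `null`
(the null set `N_G`) of the group semiring `ℕ[G]` such that `0 ∈ N_G`, `1 ∉ N_G`, there is a unique
`ε ∈ G` with `1 + ε ∈ N_G`, and `N_G` is stable under multiplication by elements of `G`. -/
structure Tract (G : Type u) [CommGroup G] where
  null : Set (MonoidAlgebra ℕ G)
  zero_mem : 0 ∈ null
  one_notMem : 1 ∉ null
  existsUnique_eps : ∃! ε : G, 1 + MonoidAlgebra.of ℕ G ε ∈ null
  smul_mem : ∀ (g : G) (x : MonoidAlgebra ℕ G), x ∈ null → MonoidAlgebra.of ℕ G g * x ∈ null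

namespace Tract

/-- A homomorphism of tracts: a group homomorphism whose `ℕ`-linear extension
to the group semirings maps null elements to null elements. -/
structure Hom {G : Type u} {G' : Type v} [CommGroup G] [CommGroup G']
    (F : Tract G) (F' : Tract G') where
  toMonoidHom : G →* G'
  map_null : ∀ x ∈ F.null, MonoidAlgebra.mapDomain toMonoidHom x ∈ F'.null

/-- An involution of a tract: an endomorphism whose square is the identity. -/
structure Involution {G : Type u} [CommGroup G] (F : Tract G) extends Hom F F where
  involutive : ∀ g : G, toMonoidHom (toMonoidHom g) = g

variable {G : Type u} [CommGroup G] {E : Type v}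

/-- The inclusion of (the underlying set of the tract) `F = G ∪ {0}` into `ℕ[G]`. -/
noncomputable def toSum (x : WithZero G) : MonoidAlgebra ℕ G :=
  WithZero.recZeroCoe 0 (fun g => MonoidAlgebra.of ℕ G g) x

/-- The action of an involution on `F = G ∪ {0}`, fixing `0`. -/
noncomputable def Involution.bar {F : Tract G} (τ : F.Involution) (x : WithZero G) : WithZero G :=
  WithZero.map' τ.toMonoidHom x

/-- The unique `ε ∈ G` with `1 + ε ∈ N_G`; it plays the role of `-1`. -/
noncomputable def eps (F : Tract G) : G := F.existsUnique_eps.choose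

/-- The negative `-x = ε x` of an element of `F`. -/
noncomputable def neg (F : Tract G) (x : WithZero G) : WithZero G := (F.eps : WithZero G) * x

/-- Multiplication of a vector `X ∈ F^E` by a scalar `α ∈ F^× = G`. -/
def scale (α : G) (X : E → WithZero G) : E → WithZero G := fun e => (α : WithZero G) * X e

/-- The support of a vector `X ∈ F^E`. -/
def supp (X : E → WithZero G) : Set E := {e | X e ≠ 0}

/-- The set of supports of the elements of `C ⊆ F^E`. -/
def supports (C : Set (E → WithZero G)) : Set (Set E) := supp '' C

/-- Orthogonality `X ⊥ Y`: the inner product `∑ X(e) * bar (Y(e)) ∈ ℕ[G]` lies in `N_G`. -/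
def Orthogonal [Fintype E] (F : Tract G) (τ : F.Involution) (X Y : E → WithZero G) : Prop :=
  ∑ e : E, toSum (X e * τ.bar (Y e)) ∈ F.null

/-- `S^⊥`, the set of all `X ∈ F^E` with `X ⊥ Y` for all `Y ∈ S`. -/
def orth [Fintype E] (F : Tract G) (τ : F.Involution) (S : Set (E → WithZero G)) :
    Set (E → WithZero G) :=
  {X | ∀ Y ∈ S, F.Orthogonal τ X Y}

/-- The elements of `S` of minimal support. -/
def suppMin (S : Set (E → WithZero G)) : Set (E → WithZero G) :=
  {X ∈ S | ∀ Y ∈ S, supp Y ⊆ supp X → supp Y = supp X}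

/-- The unions of subfamilies of `S` (the empty union included), ordered by inclusion. -/
def unionLattice (S : Set (Set E)) : Set (Set E) := {U | ∃ T ⊆ S, U = ⋃₀ T}

/-- A family of members of `S` is modular if the height of its join (that is, its union) in the
lattice of unions of members of `S` equals the size of the family. Here the height of `U` is the
largest `n` such that there is a chain `U₀ < U₁ < ⋯ < Uₙ = U`. -/
def IsModularFamily (S : Set (Set E)) {n : ℕ} (A : Fin n → Set E) : Prop :=
  (∀ i, A i ∈ S) ∧
    ∃ h : (⋃ i, A i) ∈ unionLattice S,
      Order.height (⟨⋃ i, A i, h⟩ : unionLattice S) = (n : ℕ∞)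

/-- Strong modular elimination, for `C ⊆ F^E`. -/
def StrongModularElimination (F : Tract G) (C : Set (E → WithZero G)) : Prop :=
  ∀ (k : ℕ) (X : E → WithZero G) (Xs : Fin k → E → WithZero G) (e : Fin k → E),
    X ∈ C → (∀ i, Xs i ∈ C) →
    IsModularFamily (supports C)
      (fun i : Fin (k + 1) => supp ((Fin.cons X Xs : Fin (k + 1) → E → WithZero G) i)) →
    ¬ supp X ⊆ ⋃ i, supp (Xs i) →
    (∀ i, e i ∈ supp X ∩ supp (Xs i)) →
    (∀ i j, j ≠ i → e i ∉ supp (Xs j)) →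
    (∀ i, X (e i) = F.neg (Xs i (e i))) →
    ∃ Z ∈ C, (∀ i, Z (e i) = 0) ∧
      ∀ f : E, (∑ i, toSum (Xs i f)) + toSum (X f) + toSum (F.neg (Z f)) ∈ F.null

/-- A strong `F`-matroid on `E`, given by its set of `F`-circuits. -/
structure StrongMatroid (F : Tract G) (E : Type v) where
  circuits : Set (E → WithZero G)
  zero_notMem : 0 ∉ circuits
  scale_mem : ∀ (α : G), ∀ X ∈ circuits, scale α X ∈ circuits
  incomparable : ∀ X ∈ circuits, ∀ Y ∈ circuits, supp X ⊆ supp Y → ∃ α : G, X = scale α Y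
  elimination : F.StrongModularElimination circuits

/-- `M` is the underlying matroid of the strong `F`-matroid `N`: it is the matroid on `E` whose
circuits are the supports of the `F`-circuits of `N`. -/
def StrongMatroid.HasUnderlying {F : Tract G} (N : F.StrongMatroid E) (M : Matroid E) : Prop :=
  M.E = Set.univ ∧ ∀ K : Set E, M.IsCircuit K ↔ K ∈ supports N.circuits

/-- `N'` is the dual of the strong `F`-matroid `N`: it is the strong `F`-matroid whose set of
`F`-circuits is `SuppMin(C^⊥ - {0})`, where `C` is the set of `F`-circuits of `N`. -/
def StrongMatroid.IsDual [Fintype E] {F : Tract G} (τ : F.Involution)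
    (N N' : F.StrongMatroid E) : Prop :=
  N'.circuits = suppMin (F.orth τ N.circuits \ {0})

/-- `D` is the set of `F`-cocircuits of the strong `F`-matroid `N`, that is, the set of `F`-circuits
of its dual. -/
def StrongMatroid.IsCocircuitSet [Fintype E] {F : Tract G} (τ : F.Involution)
    (N : F.StrongMatroid E) (D : Set (E → WithZero G)) : Prop :=
  ∃ N' : F.StrongMatroid E, N.IsDual τ N' ∧ N'.circuits = D

/-- `C ⊆ F^E` is an `F`-signature of the matroid `M` on `E`: it does not contain `0`, it is stable
under scaling by `F^×`, and taking supports is a bijection from the projectivization of `C` (the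
set of classes of elements of `C` modulo scaling by `F^×`) to the set of circuits of `M`.
The last three fields say that this map is well defined, surjective and injective. -/
structure IsSignature (C : Set (E → WithZero G)) (M : Matroid E) : Prop where
  zero_notMem : 0 ∉ C
  scale_mem : ∀ (α : G), ∀ X ∈ C, scale α X ∈ C
  isCircuit_supp : ∀ X ∈ C, M.IsCircuit (supp X)
  exists_supp_eq : ∀ K, M.IsCircuit K → ∃ X ∈ C, supp X = K
  eq_scale : ∀ X ∈ C, ∀ Y ∈ C, supp X = supp Y → ∃ α : G, X = scale α Y

end Tract

/-! Cocircuits are orthogonal to circuits by definition, so the content is the converse, whose core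
is `IsSignature.strongModularElimination`. Let `U` be the union of a modular family `X, X₁, …, X_k`,
let `e ∈ X` lie outside all `Xᵢ`, and let `B` be `U` without `e` and the `pᵢ` to be eliminated.
Modularity makes `B` independent, and the given circuits show that it spans `U`. The required `Z` is
the fundamental circuit of `e` over `B`, scaled so that `Z(e) = X(e)`. At `f ∈ B`, a signed
cocircuit `Y` meeting `U` only in `f`, `e` and the `pᵢ` has two-term relations with `Xᵢ` and `Z`;
substituting them into `X ⊥ Y` gives the elimination relation times `bar (Y f)`.

The hypothesis is symmetric in `C` and `D`, so both are strong matroids. They are dual because the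
support of a nonzero vector of `C^⊥` contains a cocircuit, and such a vector supported on a
cocircuit is unique up to scaling. -/

namespace Tract

/-! ### Null sums of one and two terms. -/

section Arithmetic

variable {G : Type u} [CommGroup G] (F : Tract G)

@[simp] lemma toSum_zero : toSum (0 : WithZero G) = 0 := rfl

@[simp] lemma toSum_coe (g : G) : toSum (g : WithZero G) = MonoidAlgebra.of ℕ G g := rfl

lemma toSum_coe_mul (g : G) (x : WithZero G) :
    toSum ((g : WithZero G) * x) = MonoidAlgebra.of ℕ G g * toSum x := by
  induction x using WithZero.recZeroCoe with
  | zero => simp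
  | coe h => rw [← WithZero.coe_mul, toSum_coe, toSum_coe, map_mul]

lemma of_mul_mem_null_iff (g : G) (x : MonoidAlgebra ℕ G) :
    MonoidAlgebra.of ℕ G g * x ∈ F.null ↔ x ∈ F.null := by
  refine ⟨fun h => ?_, F.smul_mem g x⟩
  have := F.smul_mem g⁻¹ _ h
  rwa [← mul_assoc, ← map_mul, inv_mul_cancel, map_one, one_mul] at this

lemma one_add_eps_mem : 1 + MonoidAlgebra.of ℕ G F.eps ∈ F.null :=
  F.existsUnique_eps.choose_spec.1

lemma eq_eps_of_one_add_mem {g : G} (h : 1 + MonoidAlgebra.of ℕ G g ∈ F.null) : g = F.eps :=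
  F.existsUnique_eps.choose_spec.2 g h

/-- Scaling `1 + ε` by `ε⁻¹` gives `1 + ε⁻¹`, so `ε⁻¹ = ε` by uniqueness. -/
lemma eps_mul_eps : F.eps * F.eps = 1 := by
  have h := F.smul_mem F.eps⁻¹ _ F.one_add_eps_mem
  rw [mul_add, mul_one, ← map_mul, inv_mul_cancel, map_one, add_comm] at h
  nth_rewrite 1 [← F.eq_eps_of_one_add_mem h]
  exact inv_mul_cancel _

lemma neg_neg (x : WithZero G) : F.neg (F.neg x) = x := by
  rw [neg, neg, ← mul_assoc, ← WithZero.coe_mul, eps_mul_eps, WithZero.coe_one, one_mul]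

lemma neg_mul (x y : WithZero G) : F.neg x * y = F.neg (x * y) := mul_assoc _ _ _

lemma eq_zero_of_toSum_mem {x : WithZero G} (h : toSum x ∈ F.null) : x = 0 := by
  induction x using WithZero.recZeroCoe with
  | zero => rfl
  | coe g =>
    rw [toSum_coe, ← mul_one (MonoidAlgebra.of ℕ G g), of_mul_mem_null_iff] at h
    exact absurd h F.one_notMem

lemma toSum_add_toSum_mem_iff {x y : WithZero G} :
    toSum x + toSum y ∈ F.null ↔ y = F.neg x := by
  induction x using WithZero.recZeroCoe with
  | zero =>
    simp only [toSum_zero, zero_add, neg, mul_zero]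
    exact ⟨F.eq_zero_of_toSum_mem, fun h => by simpa [h] using F.zero_mem⟩
  | coe g =>
    have key : toSum (g : WithZero G) + toSum y ∈ F.null ↔
        1 + toSum (((g⁻¹ : G) : WithZero G) * y) ∈ F.null := by
      rw [← F.of_mul_mem_null_iff g⁻¹, mul_add, toSum_coe, ← map_mul, inv_mul_cancel, map_one,
        toSum_coe_mul]
    rw [key]
    induction y using WithZero.recZeroCoe with
    | zero =>
      simp only [mul_zero, toSum_zero, add_zero, F.one_notMem, false_iff, neg, ← WithZero.coe_mul]
      exact WithZero.zero_ne_coe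
    | coe h =>
      rw [← WithZero.coe_mul, toSum_coe, neg, ← WithZero.coe_mul, WithZero.coe_inj]
      constructor
      · intro hm
        rw [← F.eq_eps_of_one_add_mem hm, mul_comm, mul_inv_cancel_left]
      · rintro rfl
        rw [mul_comm F.eps, inv_mul_cancel_left]
        exact F.one_add_eps_mem

end Arithmetic

/-! ### The involution, and orthogonality of vectors with small common support. -/

section Involution

variable {G : Type u} [CommGroup G] {F : Tract G} (τ : F.Involution)

lemma Involution.bar_mul (x y : WithZero G) : τ.bar (x * y) = τ.bar x * τ.bar y :=
  map_mul (WithZero.map' τ.toMonoidHom) x y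

lemma Involution.bar_coe (g : G) : τ.bar (g : WithZero G) = (τ.toMonoidHom g : G) := rfl

lemma Involution.bar_zero : τ.bar 0 = 0 := rfl

lemma Involution.bar_bar (x : WithZero G) : τ.bar (τ.bar x) = x := by
  induction x using WithZero.recZeroCoe with
  | zero => rfl
  | coe g => rw [τ.bar_coe, τ.bar_coe, τ.involutive]

lemma Involution.bar_ne_zero {x : WithZero G} : τ.bar x ≠ 0 ↔ x ≠ 0 := by
  induction x using WithZero.recZeroCoe with
  | zero => simp [τ.bar_zero]
  | coe g => simp [τ.bar_coe]

lemma Involution.mapDomain_toSum (x : WithZero G) :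
    MonoidAlgebra.mapDomain τ.toMonoidHom (toSum x) = toSum (τ.bar x) := by
  induction x using WithZero.recZeroCoe with
  | zero => exact MonoidAlgebra.mapDomain_zero _
  | coe g =>
    rw [τ.bar_coe, toSum_coe, toSum_coe, MonoidAlgebra.of_apply, MonoidAlgebra.mapDomain_single,
      MonoidAlgebra.of_apply]

variable {E : Type v} [Fintype E] {τ} {X Y : E → WithZero G}

lemma Orthogonal.symm (h : F.Orthogonal τ X Y) : F.Orthogonal τ Y X := by
  have h' := τ.map_null _ h
  change MonoidAlgebra.mapDomainNonUnitalRingHom ℕ τ.toMonoidHom.toMulHom _ ∈ _ at h'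
  rw [map_sum] at h'
  change ∑ a, MonoidAlgebra.mapDomain τ.toMonoidHom _ ∈ _ at h'
  simpa only [Orthogonal, τ.mapDomain_toSum, τ.bar_mul, τ.bar_bar, mul_comm] using h'

lemma Orthogonal.sum_mem (h : F.Orthogonal τ X Y) (s : Finset E)
    (hs : supp X ∩ supp Y ⊆ s) : ∑ a ∈ s, toSum (X a * τ.bar (Y a)) ∈ F.null := by
  rw [Finset.sum_subset (Finset.subset_univ s)]
  · exact h
  · intro a _ ha
    by_cases hX : X a = 0
    · simp [hX]
    · have hY : Y a = 0 := by
        by_contra hY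
        exact ha (hs ⟨hX, hY⟩)
      simp [hY, τ.bar_zero]

lemma Orthogonal.inter_ne_singleton (h : F.Orthogonal τ X Y) (a : E) :
    supp X ∩ supp Y ≠ {a} := by
  intro ha
  have h1 := h.sum_mem {a} (by simp [ha])
  rw [Finset.sum_singleton] at h1
  have ha' : a ∈ supp X ∩ supp Y := ha ▸ rfl
  exact mul_ne_zero ha'.1 (τ.bar_ne_zero.2 ha'.2) (F.eq_zero_of_toSum_mem h1)

lemma Orthogonal.mul_bar_eq_neg (h : F.Orthogonal τ X Y) {a b : E} (hab : a ≠ b)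
    (hs : supp X ∩ supp Y ⊆ {a, b}) : X b * τ.bar (Y b) = F.neg (X a * τ.bar (Y a)) := by
  classical
  have h1 := h.sum_mem {a, b} (by simpa using hs)
  rw [Finset.sum_pair hab] at h1
  exact F.toSum_add_toSum_mem_iff.1 h1

end Involution

/-! ### Supports and scaling. -/

section Support

variable {G : Type u} {E : Type v}

lemma supp_nonempty {X : E → WithZero G} (h : X ≠ 0) : (supp X).Nonempty :=
  Function.ne_iff.1 h

variable [CommGroup G]

@[simp] lemma supp_scale (α : G) (X : E → WithZero G) : supp (scale α X) = supp X := by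
  ext a
  simp [supp, scale]

lemma exists_scale_apply_eq {X : E → WithZero G} {a : E} (ha : a ∈ supp X) {c : WithZero G}
    (hc : c ≠ 0) : ∃ α : G, scale α X a = c := by
  obtain ⟨α, hα⟩ := WithZero.ne_zero_iff_exists.1 (div_ne_zero hc ha)
  exact ⟨α, by rw [scale, hα, div_mul_cancel₀ _ ha]⟩

end Support

/-! ### Lower bounds for height in the lattice of unions. -/

section UnionLattice

variable {E : Type v} {S : Set (Set E)}

/-- Members of `S` each containing a point outside all the previous ones generate a chain. -/
lemma le_height_of_forall_exists_notMem {n : ℕ} (K : Fin n → Set E) (hK : ∀ i, K i ∈ S)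
    (x : Fin n → E) (hx : ∀ i, x i ∈ K i) (hx' : ∀ i j, j < i → x i ∉ K j)
    (U : unionLattice S) (hU : ∀ i, K i ⊆ U) : (n : ℕ∞) ≤ Order.height U := by
  induction n generalizing U with
  | zero => simp
  | succ n ih =>
    have hV : (⋃ i : Fin n, K i.castSucc) ∈ unionLattice S :=
      ⟨Set.range fun i : Fin n => K i.castSucc, by rintro _ ⟨i, rfl⟩; exact hK _,
        (Set.sUnion_range _).symm⟩
    have h1 := ih (fun i => K i.castSucc) (fun i => hK _) (fun i => x i.castSucc)
      (fun i => hx _) (fun i j hij => hx' _ _ (by simpa using hij)) ⟨_, hV⟩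
      (fun i => Set.subset_iUnion (fun i : Fin n => K i.castSucc) i)
    have hlt : (⟨_, hV⟩ : unionLattice S) < U := by
      refine lt_of_le_of_ne (Set.iUnion_subset fun i => hU _) fun heq => ?_
      have hmem : x (Fin.last n) ∈ (U : Set E) := hU _ (hx _)
      rw [← heq] at hmem
      obtain ⟨i, hi⟩ := Set.mem_iUnion.1 hmem
      exact hx' _ _ (Fin.castSucc_lt_last i) hi
    calc ((n + 1 : ℕ) : ℕ∞) = n + 1 := by push_cast; rfl
      _ ≤ Order.height _ + 1 := by gcongr
      _ ≤ Order.height U := Order.height_add_one_le hlt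

end UnionLattice

/-! ### Circuits meeting a set or a cocircuit in few elements. -/

section Matroid

variable {E : Type v} {M : Matroid E}

/-- A nonempty set meeting no circuit in exactly one element contains a cocircuit. -/
lemma exists_isCircuit_dual_subset (hM : M.E = Set.univ) {W : Set E} (hW : W.Nonempty)
    (h : ∀ K, M.IsCircuit K → ∀ a, K ∩ W ≠ {a}) : ∃ K ⊆ W, M✶.IsCircuit K := by
  by_contra! hcon
  have hind : M.Coindep W := by
    rw [Matroid.coindep_def, Matroid.indep_iff_forall_subset_not_isCircuit (by simp [hM])]
    exact hcon
  -- For a base `B` avoiding `W`, the fundamental circuit of any `a ∈ W` meets `W` in `a` alone.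
  obtain ⟨B, hB, hWB⟩ := hind.exists_subset_compl_isBase
  obtain ⟨a, ha⟩ := hW
  have haB : a ∉ B := (hWB ha).2
  refine h _ (hB.fundCircuit_isCircuit (by simp [hM]) haB) a (Set.Subset.antisymm ?_ ?_)
  · rintro b ⟨hb, hbW⟩
    exact (M.fundCircuit_subset_insert a B hb).resolve_right (hWB hbW).2
  · rintro _ rfl
    exact ⟨M.mem_fundCircuit _ _, ha⟩

/-- For two elements of a cocircuit there is a circuit containing the second one
and meeting the cocircuit in these two elements only. -/
lemma exists_isCircuit_inter_subset_pair (hM : M.E = Set.univ) {K : Set E}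
    (hK : M✶.IsCircuit K) {a b : E} (ha : a ∈ K) (hb : b ∈ K) (hab : a ≠ b) :
    ∃ L, M.IsCircuit L ∧ b ∈ L ∧ L ∩ K ⊆ {a, b} := by
  have hind : M.Coindep (K \ {a}) := hK.sdiff_singleton_indep ha
  -- `B` avoids `K` except possibly at `a`, so the fundamental circuit of `b` meets `K` within `{a,
  -- b}`.
  obtain ⟨B, hB, hKB⟩ := hind.exists_subset_compl_isBase
  have hbB : b ∉ B := (hKB ⟨hb, hab.symm⟩).2
  refine ⟨_, hB.fundCircuit_isCircuit (by simp [hM]) hbB, M.mem_fundCircuit _ _, ?_⟩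
  rintro c ⟨hc, hcK⟩
  rcases M.fundCircuit_subset_insert b B hc with rfl | hcB
  · exact Or.inr rfl
  · exact Or.inl (by_contra fun hca => (hKB ⟨hcK, hca⟩).2 hcB)

end Matroid

/-! ### Orthogonal signatures of a matroid and its dual. -/

section DualPair

variable {G : Type u} [CommGroup G] {F : Tract G} {E : Type v} {M : Matroid E}
  {C D : Set (E → WithZero G)}

lemma IsSignature.mem_supports_iff (hC : IsSignature C M) {K : Set E} :
    K ∈ supports C ↔ M.IsCircuit K :=
  ⟨by rintro ⟨X, hX, rfl⟩; exact hC.isCircuit_supp X hX, hC.exists_supp_eq K⟩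

lemma IsSignature.exists_apply_eq (hC : IsSignature C M) {K : Set E} (hK : M.IsCircuit K)
    {a : E} (ha : a ∈ K) {c : WithZero G} (hc : c ≠ 0) : ∃ X ∈ C, supp X = K ∧ X a = c := by
  obtain ⟨X, hX, rfl⟩ := hC.exists_supp_eq K hK
  obtain ⟨α, hα⟩ := exists_scale_apply_eq ha hc
  exact ⟨_, hC.scale_mem α X hX, supp_scale α X, hα⟩

lemma IsSignature.incomparable (hC : IsSignature C M) :
    ∀ X ∈ C, ∀ Y ∈ C, supp X ⊆ supp Y → ∃ α : G, X = scale α Y := fun X hX Y hY hXY =>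
  hC.eq_scale X hX Y hY
    ((hC.isCircuit_supp X hX).eq_of_subset_isCircuit (hC.isCircuit_supp Y hY) hXY)

variable [Fintype E] {τ : F.Involution}

theorem IsSignature.strongModularElimination (hM : M.E = Set.univ) (hC : IsSignature C M)
    (hD : IsSignature D M✶) (h : ∀ X ∈ C, ∀ Y ∈ D, F.Orthogonal τ X Y) :
    F.StrongModularElimination C := by
  classical
  intro k X Xs p hX hXs hmod hnot hp hp' hpX
  obtain ⟨e, heX, he⟩ := Set.not_subset.1 hnot
  simp only [Set.mem_iUnion, not_exists] at he
  obtain ⟨-, hUl, hheight⟩ := hmod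
  set U : Set E := ⋃ i : Fin (k + 1), supp ((Fin.cons X Xs : Fin (k + 1) → E → WithZero G) i)
    with hUdef
  have hXU : supp X ⊆ U := Set.subset_iUnion
    (fun i => supp ((Fin.cons X Xs : Fin (k + 1) → E → WithZero G) i)) 0
  have hXsU : ∀ i, supp (Xs i) ⊆ U := fun i => Set.subset_iUnion
    (fun i => supp ((Fin.cons X Xs : Fin (k + 1) → E → WithZero G) i)) i.succ
  have hUX : ∀ a ∈ U, a ∈ supp X ∨ ∃ i, a ∈ supp (Xs i) := by
    intro a ha
    obtain ⟨i, hi⟩ := Set.mem_iUnion.1 ha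
    induction i using Fin.cases with
    | zero => exact Or.inl hi
    | succ i => exact Or.inr ⟨i, hi⟩
  have hep : ∀ i, e ≠ p i := fun i hi => he i (hi ▸ (hp i).2)
  have hpinj : Function.Injective p := fun i j hij => by
    by_contra hne
    exact hp' i j (Ne.symm hne) (hij ▸ (hp j).2)
  set B : Set E := U \ insert e (Set.range p) with hBdef
  have hBU : B ⊆ U := Set.sdiff_subset
  have heB : e ∉ B := fun h => h.2 (Set.mem_insert _ _)
  have hpB : ∀ i, p i ∉ B := fun i h => h.2 (Or.inr ⟨i, rfl⟩)
  have hUB : ∀ a ∈ U, a ≠ e → (∀ i, a ≠ p i) → a ∈ B := by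
    rintro a haU hae hap
    refine ⟨haU, ?_⟩
    rintro (rfl | ⟨i, rfl⟩)
    exacts [hae rfl, hap i rfl]
  have hBind : M.Indep B := by
    rw [Matroid.indep_iff_forall_subset_not_isCircuit (by simp [hM])]
    intro K hKB hK
    obtain ⟨x₀, hx₀⟩ := hK.nonempty
    -- A circuit `K ⊆ B` followed by `X₁, …, X_k, X`, with new points `x₀, p₁, …, p_k, e`, would
    -- force height at least `k + 2`.
    have hle := le_height_of_forall_exists_notMem (S := supports C)
      (Fin.cons K (Fin.snoc (fun i => supp (Xs i)) (supp X)) : Fin (k + 1 + 1) → Set E)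
      (by
        intro i
        induction i using Fin.cases with
        | zero => exact hC.mem_supports_iff.2 hK
        | succ i =>
          induction i using Fin.lastCases with
          | last => simpa using ⟨X, hX, rfl⟩
          | cast i => simpa using ⟨Xs i, hXs i, rfl⟩)
      (Fin.cons x₀ (Fin.snoc p e) : Fin (k + 1 + 1) → E)
      (by
        intro i
        induction i using Fin.cases with
        | zero => exact hx₀
        | succ i =>
          induction i using Fin.lastCases with
          | last => simpa using heX
          | cast i => simpa using (hp i).2)
      (by
        intro i j hij
        induction i using Fin.cases with
        | zero => exact absurd hij (Fin.not_lt_zero j)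
        | succ i =>
          induction j using Fin.cases with
          | zero =>
            induction i using Fin.lastCases with
            | last => simpa using fun h => heB (hKB h)
            | cast i => simpa using fun h => hpB i (hKB h)
          | succ j =>
            have hij' : j < i := Fin.succ_lt_succ_iff.1 hij
            induction j using Fin.lastCases with
            | last => exact absurd hij' (Fin.le_last i).not_gt
            | cast j =>
              induction i using Fin.lastCases with
              | last => simpa using he j
              | cast i =>
                simpa using hp' i j (ne_of_lt (by simpa using hij')))
      ⟨U, hUl⟩
      (by
        intro i
        induction i using Fin.cases with
        | zero => exact hKB.trans hBU
        | succ i =>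
          induction i using Fin.lastCases with
          | last => simpa using hXU
          | cast i => simpa using hXsU i)
    rw [hheight] at hle
    have : k + 1 + 1 ≤ k + 1 := by exact_mod_cast hle
    omega
  -- `supp (Xs i)` leaves `B` only at `p i`.
  have hpcl : ∀ i, p i ∈ M.closure B := by
    intro i
    refine M.closure_subset_closure ?_
      ((hC.isCircuit_supp _ (hXs i)).mem_closure_sdiff_singleton_of_mem (hp i).2)
    rintro a ⟨ha, hai⟩
    refine hUB a (hXsU i ha) ?_ fun j => ?_
    · rintro rfl
      exact he i ha
    · rintro rfl
      by_cases hij : i = j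
      · exact hai (by rw [hij]; rfl)
      · exact hp' j i hij ha
  have hecl : e ∈ M.closure B := by
    refine M.closure_subset_closure_of_subset_closure ?_
      ((hC.isCircuit_supp _ hX).mem_closure_sdiff_singleton_of_mem heX)
    rintro a ⟨ha, hae⟩
    by_cases hap : ∃ i, a = p i
    · obtain ⟨i, rfl⟩ := hap
      exact hpcl i
    · exact M.subset_closure B (by simp [hM]) (hUB a (hXU ha) hae (not_exists.1 hap))
  have hUcl : U ⊆ M.closure B := by
    intro a haU
    by_cases haB : a ∈ B
    · exact M.subset_closure B (by simp [hM]) haB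
    · by_cases hae : a = e
      · exact hae ▸ hecl
      · by_cases hap : ∃ i, a = p i
        · obtain ⟨i, rfl⟩ := hap
          exact hpcl i
        · exact absurd (hUB a haU hae (not_exists.1 hap)) haB
  obtain ⟨Z, hZ, hZsupp, hZe⟩ := hC.exists_apply_eq (hBind.fundCircuit_isCircuit hecl heB)
    (M.mem_fundCircuit e B) heX
  have hZB : supp Z ⊆ insert e B := hZsupp ▸ M.fundCircuit_subset_insert e B
  have hZp : ∀ i, Z (p i) = 0 := fun i => by
    by_contra hne
    exact (hZB hne).elim (fun h => hep i h.symm) (hpB i)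
  refine ⟨Z, hZ, hZp, fun f => ?_⟩
  by_cases hfU : f ∉ U
  · have h1 : X f = 0 := by_contra fun hne => hfU (hXU hne)
    have h2 : ∀ i, Xs i f = 0 := fun i => by_contra fun hne => hfU (hXsU i hne)
    have h3 : Z f = 0 := by
      by_contra hne
      rcases hZB hne with rfl | hf
      exacts [hfU (hXU heX), hfU (hBU hf)]
    simpa [h1, h2, h3, neg] using F.zero_mem
  rw [not_not] at hfU
  by_cases hfe : f = e
  · subst hfe
    have h2 : ∀ i, Xs i f = 0 := fun i => by_contra fun hne => he i hne
    simp only [h2, toSum_zero, Finset.sum_const_zero, zero_add]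
    exact F.toSum_add_toSum_mem_iff.2 (by rw [hZe])
  by_cases hfp : ∃ i, f = p i
  · obtain ⟨i, rfl⟩ := hfp
    have h2 : ∀ j, j ≠ i → Xs j (p i) = 0 := fun j hj => by_contra fun hne => hp' i j hj hne
    rw [Finset.sum_eq_single i (fun j _ hj => by rw [h2 j hj, toSum_zero]) (by simp), hZp i]
    simpa [neg] using F.toSum_add_toSum_mem_iff.2 (hpX i)
  have hfB : f ∈ B := hUB f hfU hfe (not_exists.1 hfp)
  -- The fundamental cocircuit of `f` for a base `B' ⊇ B` avoids `B` except at `f`.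
  obtain ⟨B', hB', hBB'⟩ := hBind.exists_isBase_superset
  have hB'U : ∀ a ∈ B', a ∈ U → a ∈ B := by
    intro a haB' haU
    by_contra haB
    have := hB'.indep.notMem_closure_sdiff_of_mem haB'
    refine this (M.closure_subset_closure (Set.subset_sdiff_singleton hBB' haB) (hUcl haU))
  obtain ⟨Y, hY, hYsupp⟩ := hD.exists_supp_eq _ (M.fundCocircuit_isCocircuit (hBB' hfB) hB')
  have hYf : Y f ≠ 0 := by
    have : f ∈ supp Y := hYsupp ▸ M.mem_fundCocircuit f B'
    exact this
  have hYU : ∀ a ∈ supp Y, a ∈ U → a = f ∨ a = e ∨ ∃ i, a = p i := by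
    intro a haY haU
    rw [hYsupp] at haY
    rcases M.fundCocircuit_subset_insert_compl f B' haY with rfl | ha
    · exact Or.inl rfl
    · by_contra! hcon
      exact ha.2 (hBB' (hUB a haU hcon.2.1 hcon.2.2))
  obtain ⟨c, hc⟩ := WithZero.ne_zero_iff_exists.1 (τ.bar_ne_zero.2 hYf)
  -- `Xs i` and `Y` share at most `p i` and `f`; the sign of their two-term relation cancels against
  -- `X (p i) = -Xs i (p i)`.
  have hXsf : ∀ i, (c : WithZero G) * Xs i f = X (p i) * τ.bar (Y (p i)) := by
    intro i
    rw [hc, mul_comm, (h _ (hXs i) _ hY).mul_bar_eq_neg (a := p i) (b := f)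
      (fun hi => hfp ⟨i, hi.symm⟩), hpX i, neg_mul]
    rintro a ⟨haX, haY⟩
    rcases hYU a haY (hXsU i haX) with rfl | rfl | ⟨j, rfl⟩
    · exact Or.inr rfl
    · exact absurd haX (he i)
    · by_cases hij : i = j
      · exact Or.inl (by rw [hij])
      · exact absurd haX (hp' j i hij)
  have hZf : (c : WithZero G) * F.neg (Z f) = X e * τ.bar (Y e) := by
    rw [hc, mul_comm, neg_mul, (h _ hZ _ hY).mul_bar_eq_neg (a := e) (b := f)
      (fun hi => hfe hi.symm), neg_neg, hZe]
    rintro a ⟨haZ, haY⟩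
    rcases hZB haZ with rfl | haB
    · exact Or.inl rfl
    · rcases hYU a haY (hBU haB) with rfl | rfl | ⟨j, rfl⟩
      · exact Or.inr rfl
      · exact Or.inl rfl
      · exact absurd haB (hpB j)
  have hsum := (h _ hX _ hY).sum_mem (insert f (insert e (Finset.univ.image p))) (by
    rintro a ⟨haX, haY⟩
    rcases hYU a haY (hXU haX) with rfl | rfl | ⟨j, rfl⟩ <;> simp)
  rw [Finset.sum_insert (by
      simp only [Finset.mem_insert, Finset.mem_image, Finset.mem_univ, true_and, not_or]
      exact ⟨hfe, fun ⟨i, hi⟩ => hfp ⟨i, hi.symm⟩⟩),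
    Finset.sum_insert (by
      simp only [Finset.mem_image, Finset.mem_univ, true_and]
      exact fun ⟨i, hi⟩ => hep i hi.symm),
    Finset.sum_image hpinj.injOn] at hsum
  -- Multiplied by `c = bar (Y f)`, the goal becomes `X ⊥ Y` term by term.
  rw [← F.of_mul_mem_null_iff c, mul_add, mul_add, Finset.mul_sum]
  simp only [← toSum_coe_mul, hXsf, hZf]
  rw [hc, mul_comm _ (X f)]
  convert hsum using 1
  abel

/-- The strong matroid whose circuits are one half of a dual pair of signatures. -/
def IsSignature.strongMatroid (hM : M.E = Set.univ) (hC : IsSignature C M)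
    (hD : IsSignature D M✶) (h : ∀ X ∈ C, ∀ Y ∈ D, F.Orthogonal τ X Y) : F.StrongMatroid E where
  circuits := C
  zero_notMem := hC.zero_notMem
  scale_mem := hC.scale_mem
  incomparable := hC.incomparable
  elimination := hC.strongModularElimination hM hD h

/-- A nonzero single term is never null, so `supp W` meets no circuit in exactly one element. -/
lemma IsSignature.exists_supp_subset_of_mem_orth (hM : M.E = Set.univ) (hC : IsSignature C M)
    (hD : IsSignature D M✶) {W : E → WithZero G} (hW : W ∈ F.orth τ C) (hW0 : W ≠ 0) :
    ∃ Y ∈ D, supp Y ⊆ supp W := by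
  obtain ⟨K, hKW, hK⟩ := exists_isCircuit_dual_subset hM (supp_nonempty hW0) (by
    intro K hK a
    obtain ⟨X, hX, rfl⟩ := hC.exists_supp_eq K hK
    rw [Set.inter_comm]
    exact (hW X hX).inter_ne_singleton a)
  obtain ⟨Y, hY, rfl⟩ := hD.exists_supp_eq K hK
  exact ⟨Y, hY, hKW⟩

/-- A circuit meeting the cocircuit only in `a` and `b` turns orthogonality into a two-term
relation, which fixes the ratio of the values at `a` and `b`. -/
lemma IsSignature.eq_scale_of_mem_orth (hM : M.E = Set.univ) (hC : IsSignature C M)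
    {W Y : E → WithZero G} (hY : Y ∈ F.orth τ C) (hW : W ∈ F.orth τ C)
    (hK : M✶.IsCircuit (supp Y)) (hWY : supp W = supp Y) : ∃ α : G, W = scale α Y := by
  obtain ⟨a, ha⟩ := hK.nonempty
  have haW : a ∈ supp W := hWY.symm ▸ ha
  obtain ⟨α, hα⟩ := exists_scale_apply_eq ha haW
  refine ⟨α, funext fun b => ?_⟩
  by_cases hb : b ∈ supp Y
  · by_cases hab : a = b
    · rw [← hab, hα]
    obtain ⟨L, hL, hbL, hLK⟩ := exists_isCircuit_inter_subset_pair hM hK ha hb hab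
    obtain ⟨X, hX, rfl⟩ := hC.exists_supp_eq L hL
    have h1 := (hY X hX).mul_bar_eq_neg hab (by rwa [Set.inter_comm])
    have h2 := (hW X hX).mul_bar_eq_neg hab (by rwa [hWY, Set.inter_comm])
    have hXb : τ.bar (X b) ≠ 0 := τ.bar_ne_zero.2 hbL
    refine mul_right_cancel₀ hXb ?_
    rw [h2, scale, mul_assoc, h1, ← hα, scale, neg, neg]
    ac_rfl
  · have hbW : b ∉ supp W := hWY ▸ hb
    rw [show W b = 0 from not_not.1 hbW, scale, show Y b = 0 from not_not.1 hb, mul_zero]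

lemma IsSignature.eq_suppMin_orth (hM : M.E = Set.univ) (hC : IsSignature C M)
    (hD : IsSignature D M✶) (h : ∀ X ∈ C, ∀ Y ∈ D, F.Orthogonal τ X Y) :
    D = suppMin (F.orth τ C \ {0}) := by
  have hDC : ∀ Y ∈ D, Y ∈ F.orth τ C := fun Y hY X hX => (h X hX Y hY).symm
  have hD0 : ∀ Y ∈ D, Y ≠ 0 := fun Y hY h0 => hD.zero_notMem (h0 ▸ hY)
  ext Y
  constructor
  · refine fun hY => ⟨⟨hDC Y hY, hD0 Y hY⟩, fun W hW hWY => ?_⟩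
    obtain ⟨Y', hY', hYW⟩ := hC.exists_supp_subset_of_mem_orth hM hD hW.1 hW.2
    -- The cocircuit inside `supp W` also lies inside the cocircuit `supp Y`, hence equals it.
    refine hWY.antisymm ?_
    rwa [← (hD.isCircuit_supp Y' hY').eq_of_subset_isCircuit (hD.isCircuit_supp Y hY)
      (hYW.trans hWY)]
  · rintro ⟨⟨hYC, hY0⟩, hmin⟩
    obtain ⟨Y', hY', hYY⟩ := hC.exists_supp_subset_of_mem_orth hM hD hYC hY0
    obtain ⟨α, rfl⟩ := hC.eq_scale_of_mem_orth hM (hDC Y' hY') hYC (hD.isCircuit_supp Y' hY')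
      (hmin Y' ⟨hDC Y' hY', hD0 Y' hY'⟩ hYY).symm
    exact hD.scale_mem α Y' hY'

end DualPair

end Tract

theorem theorem3p12 {G : Type u} [CommGroup G] (F : Tract G) (τ : F.Involution)
    {E : Type v} [Fintype E] (M : Matroid E) (hM : M.E = Set.univ)
    (C D : Set (E → WithZero G))
    (hC : Tract.IsSignature C M) (hD : Tract.IsSignature D M✶) :
    (∃ N : F.StrongMatroid E,
        N.circuits = C ∧ N.IsCocircuitSet τ D ∧ N.HasUnderlying M) ↔
      ∀ X ∈ C, ∀ Y ∈ D, F.Orthogonal τ X Y := by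
  constructor
  · rintro ⟨N, rfl, ⟨N', hdual, rfl⟩, -⟩ X hX Y hY
    rw [hdual] at hY
    exact (hY.1.1 X hX).symm
  · intro h
    -- Needed to apply the construction with `D` and `C` exchanged, which gives the dual strong
    -- matroid.
    have hC' : Tract.IsSignature C M✶✶ := by rwa [Matroid.dual_dual]
    exact ⟨hC.strongMatroid hM hD h, rfl,
      ⟨hD.strongMatroid (M := M✶) hM hC' fun Y hY X hX => (h X hX Y hY).symm,
        hC.eq_suppMin_orth hM hD h, rfl⟩,
      hM, fun K => hC.mem_supports_iff.symm⟩
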